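/- **Setting.** Let $\mathbf g_1,\dots,\mathbf g_n$ be grid points in a domain $\mathcal D$, and let $\mathcal D$ be recursively partitioned: for $m=0,\dots,M-1$ each region $\mathcal D_{j_1,\dots,j_m}$ (with $\mathcal D$ itself for $m=0$) is the disjoint union of its $J$ subregions $\mathcal D_{j_1,\dots,j_{m+1}}$, $j_{m+1}=1,\dots,J$. Put $\mathcal I_{j_1,\dots,j_m}=\{i:\mathbf g_i\in\mathcal D_{j_1,\dots,j_m}\}$. Let the knot sets $\mathcal K_{j_1,\dots,j_m}\subset\mathcal I_{j_1,\dots,j_m}$, $0\le m\le M$, form a partition of $\{1,\dots,n\}$ such that no knot of resolution $m$ is a knot of a resolution $l<m$, with $|\mathcal K_{j_1,\dots,j_m}|\le r_m$ (in particular, $|\mathcal K_{j_1,\dots,j_m}|= r_m$ is allowed). Put $N=\sum_{m=0}^M r_m$. **Multi-resolution decomposition.** For an $n\times n$ matrix $\Sigma$ and $0\le \ell\le m\le M$ let $$W^\ell_{j_1,\dots,j_m}=\Sigma[\mathcal I_{j_1,\dots,j_m},\mathcal K_{j_1,\dots,j_\ell}]-\sum_{k=0}^{\ell-1}W^k_{j_1,\dots,j_m}(V^k_{j_1,\dots,j_k})^{-1}(V^k_{j_1,\dots,j_\ell})',$$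 $$V^\ell_{j_1,\dots,j_m}=\Sigma[\mathcal K_{j_1,\dots,j_m},\mathcal K_{j_1,\dots,j_\ell}]-\sum_{k=0}^{\ell-1}V^k_{j_1,\dots,j_m}(V^k_{j_1,\dots,j_k})^{-1}(V^k_{j_1,\dots,j_\ell})',$$ and $B_{j_1,\dots,j_m}=W^m_{j_1,\dots,j_m}(V^m_{j_1,\dots,j_m})^{-1/2}$, where $V^{-1/2}$ is any matrix $X$ with $XX'=V^{-1}$; the matrices $V^m_{j_1,\dots,j_m}$ are supposed to be invertible. Then $\mathrm{MRD}(\Sigma)=(B^M,B^{M-1},\dots,B^0)$ is the $n\times n$ matrix in which $B^m$ is block-diagonal with blocks $B_{j_1,\dots,j_m}$ in lexicographic order of $(j_1,\dots,j_m)$: a column belonging to a knot in $\mathcal K_{j_1,\dots,j_m}$ has the entries of $B_{j_1,\dots,j_m}$ in the rows $\mathcal I_{j_1,\dots,j_m}$ and zeros elsewhere. **Filter.** Consider the state-space model $\mathbf y_t=H_t\mathbf x_t+\mathbf v_t$, $\mathbf x_t=A_t\mathbf x_{t-1}+\mathbf w_t$ ($t=1,2,\dots$), where $\mathbf y_t$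 has dimension $n_t$, $\mathbf v_t\sim\mathcal N(0,R_t)$ with $R_t$ positive definite, $\mathbf w_t\sim\mathcal N(0,Q_t)$ and $\mathbf x_0$ has covariance matrix $\Sigma_{0|0}$. The multi-resolution filter sets $B_{0|0}=\mathrm{MRD}(\Sigma_{0|0})$ and, for $t=1,2,\dots$, $B_{t|t-1}=\mathrm{MRD}\big(A_tB_{t-1|t-1}(A_tB_{t-1|t-1})'+Q_t\big)$, $\Lambda_t=I_n+B_{t|t-1}'H_t'R_t^{-1}H_tB_{t|t-1}$, $L_t$ the lower Cholesky factor of $\Lambda_t$ (lower triangular with positive diagonal and $L_tL_t'=\Lambda_t$), and $B_{t|t}=B_{t|t-1}(L_t^{-1})'$. **Statement.** There is an absolute constant $C$ such that the following holds for all such data. Let the filter be run up to time $T$ and let $1\le t\le T$. Suppose that $H_t$ and $R_t$ are block-diagonal with respect to the finest subregions, i.e. each observation $i\in\{1,\dots,n_t\}$ can be assigned to a finest subregion $\rho(i)\in\{1,\dots,J\}^M$ such that $H_t[i,a]=0$ whenever $a\notin\mathcal I_{\rho(i)}$, and $R_t[i,k]=0$ whenever $\rho(i)\ne\rho(k)$.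 Then each column of $L_t$ has at most $C\,N$ nonzero entries. -/

import Mathlib

open Matrix

universe u

namespace MRF

/-- Restriction of a multi-index `(j₁,…,jₘ)` to its first `l ≤ m` entries. -/
abbrev trunc {J m l : ℕ} (j : Fin m → Fin J) (h : l ≤ m) : Fin l → Fin J :=
  fun a => j ⟨a, a.2.trans_le h⟩

/-- The product `X Z⁻¹ Yᵀ`. -/
noncomputable def mulInvMulTranspose {α β γ : Type*} [Fintype γ] [DecidableEq γ]
    (X : Matrix α γ ℝ) (Z : Matrix γ γ ℝ) (Y : Matrix β γ ℝ) : Matrix α β ℝ :=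
  X * Z⁻¹ * Yᵀ

/-- A grid of `n` points in a spatial domain `𝓓`, a recursive partitioning of `𝓓` into `J`
subregions per region down to resolution `M`, a hierarchy of knots, and the order in which the
knots label the columns of a multi-resolution factor.  Only resolutions `m ≤ M` are meaningful. -/
structure Hierarchy (𝓓 : Type u) (n J M : ℕ) where
  /-- the grid points -/
  grid : Fin n → 𝓓
  /-- `region m j` is the subregion with multi-index `j = (j₁,…,jₘ)` -/
  region : (m : ℕ) → (Fin m → Fin J) → Set 𝓓
  region_zero : ∀ j, region 0 j = Set.univ
  region_succ : ∀ m < M, ∀ j : Fin m → Fin J,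
    region m j = ⋃ a : Fin J, region (m + 1) (Fin.snoc (α := fun _ => Fin J) j a)
  region_disjoint : ∀ m < M, ∀ j : Fin m → Fin J, ∀ a b : Fin J, a ≠ b →
    Disjoint (region (m + 1) (Fin.snoc (α := fun _ => Fin J) j a))
      (region (m + 1) (Fin.snoc (α := fun _ => Fin J) j b))
  /-- `K m j` is the set of indices of the knots of the subregion `j` at resolution `m` -/
  K : (m : ℕ) → (Fin m → Fin J) → Finset (Fin n)
  /-- knots lie in their subregion -/
  K_mem : ∀ m ≤ M, ∀ j, ∀ i ∈ K m j, grid i ∈ region m j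
  /-- knots are chosen among the indices that are not knots at a coarser resolution -/
  K_new : ∀ m ≤ M, ∀ j, ∀ i ∈ K m j, ∀ l < m, ∀ j', i ∉ K l j'
  /-- every index is a knot at some resolution -/
  K_cover : ∀ i, ∃ m ≤ M, ∃ j, i ∈ K m j
  /-- `r m` bounds the number of knots per subregion at resolution `m` -/
  r : ℕ → ℕ
  K_card : ∀ m ≤ M, ∀ j, (K m j).card ≤ r m
  /-- `col c` is the knot that labels the `c`-th column of a multi-resolution factor -/
  col : Fin n ≃ Fin n
  /-- the columns run from resolution `M` down to resolution `0` -/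
  col_level : ∀ c c', c < c' → ∀ m ≤ M, ∀ m' ≤ M, ∀ j j',
    col c ∈ K m j → col c' ∈ K m' j' → m' ≤ m
  /-- within one resolution, the subregions are in lexicographic order -/
  col_lex : ∀ c c', c < c' → ∀ m ≤ M, ∀ j j' : Fin m → Fin J,
    col c ∈ K m j → col c' ∈ K m j' → toLex j ≤ toLex j'

namespace Hierarchy

variable {𝓓 : Type u} {n J M : ℕ} (P : Hierarchy 𝓓 n J M)

open Classical in
/-- The indices of the grid points in the subregion `j` at resolution `m`. -/
noncomputable def I (m : ℕ) (j : Fin m → Fin J) : Finset (Fin n) :=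
  Finset.univ.filter fun i => P.grid i ∈ P.region m j

/-- `N = r₀ + ⋯ + r_M`. -/
def N : ℕ := ∑ m ∈ Finset.range (M + 1), P.r m

/-- The matrix `V^l_{j₁,…,jₘ}` of the decomposition of `S`, for `l ≤ m`:
`V^l_{j₁,…,jₘ} = S[K_{j₁,…,jₘ}, K_{j₁,…,jₗ}]
  - ∑_{k < l} V^k_{j₁,…,jₘ} (V^k_{j₁,…,jₖ})⁻¹ (V^k_{j₁,…,jₗ})ᵀ`. -/
noncomputable def V (S : Matrix (Fin n) (Fin n) ℝ) (l : ℕ) {m : ℕ} (j : Fin m → Fin J)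
    (h : l ≤ m) : Matrix (P.K m j) (P.K l (trunc j h)) ℝ :=
  S.submatrix (fun a : P.K m j => (a : Fin n)) (fun b : P.K l (trunc j h) => (b : Fin n)) -
    ∑ k : Fin l, mulInvMulTranspose (γ := P.K k (trunc j (k.2.le.trans h)))
      (V S k j (k.2.le.trans h))
      (V S k (trunc j (k.2.le.trans h)) le_rfl)
      (V S k (trunc j h) k.2.le)
termination_by l
decreasing_by all_goals exact k.2

/-- The matrix `W^l_{j₁,…,jₘ}` of the decomposition of `S`, for `l ≤ m`:
`W^l_{j₁,…,jₘ} = S[I_{j₁,…,jₘ}, K_{j₁,…,jₗ}]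
  - ∑_{k < l} W^k_{j₁,…,jₘ} (V^k_{j₁,…,jₖ})⁻¹ (V^k_{j₁,…,jₗ})ᵀ`. -/
noncomputable def W (S : Matrix (Fin n) (Fin n) ℝ) (l : ℕ) {m : ℕ} (j : Fin m → Fin J)
    (h : l ≤ m) : Matrix (P.I m j) (P.K l (trunc j h)) ℝ :=
  S.submatrix (fun a : P.I m j => (a : Fin n)) (fun b : P.K l (trunc j h) => (b : Fin n)) -
    ∑ k : Fin l, mulInvMulTranspose (γ := P.K k (trunc j (k.2.le.trans h)))
      (W S k j (k.2.le.trans h))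
      (P.V S k (trunc j (k.2.le.trans h)) le_rfl)
      (P.V S k (trunc j h) k.2.le)
termination_by l
decreasing_by all_goals exact k.2

/-- The square matrix `V^m_{j₁,…,jₘ}`. -/
noncomputable def Vdiag (S : Matrix (Fin n) (Fin n) ℝ) {m : ℕ} (j : Fin m → Fin J) :
    Matrix (P.K m j) (P.K m j) ℝ := P.V S m j le_rfl

/-- The matrix `W^m_{j₁,…,jₘ}`. -/
noncomputable def Wdiag (S : Matrix (Fin n) (Fin n) ℝ) {m : ℕ} (j : Fin m → Fin J) :
    Matrix (P.I m j) (P.K m j) ℝ := P.W S m j le_rfl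

/-- `B` is the multi-resolution decomposition of `S`: the matrices `V^m_{j₁,…,jₘ}` are invertible,
and `B = (B^M, …, B^0)` where `B^m` is block-diagonal with the blocks
`B_{j₁,…,jₘ} = W^m_{j₁,…,jₘ} (V^m_{j₁,…,jₘ})^{-1/2}`.  An inverse square root `X` of `V` is any
matrix with `X Xᵀ = V⁻¹`, which covers both the symmetric root and the triangular one.
Rows are indexed by the grid points, columns by their position in the order `col`. -/
def IsMRD (S B : Matrix (Fin n) (Fin n) ℝ) : Prop :=
  ∃ X : (m : ℕ) → (j : Fin m → Fin J) → Matrix (P.K m j) (P.K m j) ℝ,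
    (∀ m ≤ M, ∀ j : Fin m → Fin J,
      IsUnit (P.Vdiag S j).det ∧ X m j * (X m j)ᵀ = (P.Vdiag S j)⁻¹) ∧
    ∀ m ≤ M, ∀ j : Fin m → Fin J, ∀ (c : Fin n) (hc : P.col c ∈ P.K m j),
      (∀ (i : Fin n) (hi : i ∈ P.I m j),
        B i c = (P.Wdiag S j * X m j) ⟨i, hi⟩ ⟨P.col c, hc⟩) ∧
      (∀ i : Fin n, i ∉ P.I m j → B i c = 0)

end Hierarchy

/-- The matrices of a linear Gaussian state-space model
`y_t = H_t x_t + v_t`, `x_t = A_t x_{t-1} + w_t`, `t = 1, 2, …`, with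
`v_t ∼ N(0, R_t)`, `w_t ∼ N(0, Q_t)` and initial covariance `Σ₀`; `R_t` is invertible. -/
structure StateSpaceModel (n : ℕ) where
  /-- the number of observations at time `t` -/
  nobs : ℕ → ℕ
  H : (t : ℕ) → Matrix (Fin (nobs t)) (Fin n) ℝ
  R : (t : ℕ) → Matrix (Fin (nobs t)) (Fin (nobs t)) ℝ
  A : ℕ → Matrix (Fin n) (Fin n) ℝ
  Q : ℕ → Matrix (Fin n) (Fin n) ℝ
  Sigma0 : Matrix (Fin n) (Fin n) ℝ
  R_posDef : ∀ t, (R t).PosDef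
  Q_posSemidef : ∀ t, (Q t).PosSemidef
  Sigma0_posSemidef : Sigma0.PosSemidef

/-- `L` is the lower Cholesky factor of `G`. -/
def IsLowerCholesky {n : ℕ} (L G : Matrix (Fin n) (Fin n) ℝ) : Prop :=
  (∀ i j, i < j → L i j = 0) ∧ (∀ i, 0 < L i i) ∧ L * Lᵀ = G

namespace StateSpaceModel

variable {n : ℕ} (Y : StateSpaceModel n)

/-- `Λ_t = I + Bᵀ H_tᵀ R_t⁻¹ H_t B`. -/
noncomputable def Lam (t : ℕ) (B : Matrix (Fin n) (Fin n) ℝ) : Matrix (Fin n) (Fin n) ℝ :=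
  1 + Bᵀ * (Y.H t)ᵀ * (Y.R t)⁻¹ * Y.H t * B

end StateSpaceModel

/-- The covariance part of the multi-resolution filter, run up to time `T`:
`Bpost t` is `B_{t|t}`, `Bprior t` is `B_{t|t-1}`, and `L t` is `L_t`. -/
structure IsFilterRun {𝓓 : Type u} {n J M : ℕ} (P : Hierarchy 𝓓 n J M) (Y : StateSpaceModel n)
    (T : ℕ) (Bprior Bpost L : ℕ → Matrix (Fin n) (Fin n) ℝ) : Prop where
  init : P.IsMRD Y.Sigma0 (Bpost 0)
  forecast : ∀ t < T,
    P.IsMRD ((Y.A (t + 1) * Bpost t) * (Y.A (t + 1) * Bpost t)ᵀ + Y.Q (t + 1)) (Bprior (t + 1))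
  cholesky : ∀ t < T, IsLowerCholesky (L (t + 1)) (Y.Lam (t + 1) (Bprior (t + 1)))
  update : ∀ t < T, Bpost (t + 1) = Bprior (t + 1) * ((L (t + 1))⁻¹)ᵀ

/-- `H_t` and `R_t` are block-diagonal with blocks corresponding to the finest subregions: every
observation `i` belongs to a finest subregion `ρ i`, observes only grid points in it, and has
noise that is correlated only with that of observations belonging to the same subregion. -/
def BlockObservations {𝓓 : Type u} {n J M : ℕ} (P : Hierarchy 𝓓 n J M) (Y : StateSpaceModel n)
    (t : ℕ) : Prop :=
  ∃ ρ : Fin (Y.nobs t) → (Fin M → Fin J),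
    (∀ i k, ρ i ≠ ρ k → Y.R t i k = 0) ∧
    (∀ i a, a ∉ P.I M (ρ i) → Y.H t i a = 0)

end MRF

namespace MRF

namespace Hierarchy

variable {𝓓 : Type u} {n J M : ℕ} (P : Hierarchy 𝓓 n J M)

/-! Write `i` above `c` when the knot of column `i` belongs to the subregion of the knot of `c` or
to one of its ancestors. A row of `H_t B_{t|t-1}` sees only one finest subregion, so it is supported
on the knots of the regions containing that subregion, and these regions form a chain. Since `R_t⁻¹`
does not couple finest subregions, `Λ_t` has entries on and below the diagonal only where `i` is
above `c` (`BlockObservations.isAncestor_of_lam_ne_zero`). Columns run from fine to coarse, so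
elimination proceeds from descendants to ancestors and creates no fill-in outside this pattern
(`IsLowerCholesky.rel_of_ne_zero`). A chain has at most one region per resolution, hence at most `N`
knots (`card_le_N_of_isAncestor`). -/

theorem region_succ_subset {m : ℕ} (hm : m < M) (j : Fin (m + 1) → Fin J) :
    P.region (m + 1) j ⊆ P.region m (Fin.init j) := by
  rw [P.region_succ m hm (Fin.init j)]
  intro x hx
  refine Set.mem_iUnion.2 ⟨j (Fin.last m), ?_⟩
  rwa [Fin.snoc_init_self]

/-- A region is contained in each of its ancestors. -/
theorem region_subset_trunc {l m : ℕ} (h : l ≤ m) (hm : m ≤ M) (j : Fin m → Fin J) :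
    P.region m j ⊆ P.region l (trunc j h) := by
  induction m, h using Nat.le_induction with
  | base => exact subset_rfl
  | succ m h ih => exact (P.region_succ_subset hm j).trans (ih (by omega) (Fin.init j))

/-- Regions of the same resolution that share a point coincide. -/
theorem region_index_unique {m : ℕ} (hm : m ≤ M) {j j' : Fin m → Fin J} {x : 𝓓}
    (hx : x ∈ P.region m j) (hx' : x ∈ P.region m j') : j = j' := by
  induction m with
  | zero => exact Subsingleton.elim _ _
  | succ m ih =>
    have hinit : Fin.init j = Fin.init j' :=
      ih (by omega) (P.region_succ_subset hm j hx) (P.region_succ_subset hm j' hx')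
    have hlast : j (Fin.last m) = j' (Fin.last m) := by
      by_contra hne
      have hd := P.region_disjoint m hm (Fin.init j) _ _ hne
      rw [Fin.snoc_init_self, hinit, Fin.snoc_init_self] at hd
      exact Set.disjoint_left.1 hd hx hx'
    rw [← Fin.snoc_init_self j, ← Fin.snoc_init_self j', hinit, hlast]

theorem mem_I {m : ℕ} {j : Fin m → Fin J} {i : Fin n} :
    i ∈ P.I m j ↔ P.grid i ∈ P.region m j := by
  simp [I]

/-- Each grid index is a knot of exactly one subregion. -/
theorem knot_region_unique {i : Fin n} {m m' : ℕ} (hm : m ≤ M) (hm' : m' ≤ M)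
    {j : Fin m → Fin J} {j' : Fin m' → Fin J} (h : i ∈ P.K m j) (h' : i ∈ P.K m' j') :
    (⟨m, j⟩ : Σ m, Fin m → Fin J) = ⟨m', j'⟩ := by
  obtain hlt | rfl | hlt := lt_trichotomy m m'
  · exact absurd h (P.K_new m' hm' j' i h' m hlt j)
  · rw [P.region_index_unique hm (P.K_mem _ hm _ _ h) (P.K_mem _ hm _ _ h')]
  · exact absurd h' (P.K_new m hm j i h m' hlt j')

/-- The knot `i` belongs to an ancestor of the subregion of the knot `k`, or to that subregion. -/
def IsAncestor (i k : Fin n) : Prop :=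
  ∃ (m : ℕ) (_ : m ≤ M) (j : Fin m → Fin J) (l : ℕ) (h : l ≤ m),
    k ∈ P.K m j ∧ i ∈ P.K l (trunc j h)

theorem isAncestor_refl (i : Fin n) : P.IsAncestor i i := by
  obtain ⟨m, hm, j, hi⟩ := P.K_cover i
  exact ⟨m, hm, j, m, le_rfl, hi, hi⟩

/-- Two knots below whose subregions there is a common point are ordered as their columns. -/
theorem isAncestor_of_mem_trunc {c i : Fin n} (hci : c ≤ i) {m : ℕ} (hm : m ≤ M)
    {j : Fin m → Fin J} {l l' : ℕ} (hl : l ≤ m) (hl' : l' ≤ m)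
    (hi : P.col i ∈ P.K l (trunc j hl)) (hc : P.col c ∈ P.K l' (trunc j hl')) :
    P.IsAncestor (P.col i) (P.col c) := by
  obtain rfl | hlt := hci.eq_or_lt
  · exact P.isAncestor_refl _
  -- The later column is no finer, so `l ≤ l'`; truncating `j` to `l'` and then to `l` is truncating
  -- it to `l`.
  · exact ⟨l', hl'.trans hm, trunc j hl', l,
      P.col_level c i hlt l' (hl'.trans hm) l (hl.trans hm) _ _ hc hi, hc, hi⟩

/-- The ancestors of `k` form a chain, on which the column order decides who is above whom. This is
the closure under fill-in that the Cholesky argument needs. -/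
theorem isAncestor_of_common_descendant {c i k : Fin n} (hci : c ≤ i)
    (hi : P.IsAncestor (P.col i) k) (hc : P.IsAncestor (P.col c) k) :
    P.IsAncestor (P.col i) (P.col c) := by
  obtain ⟨m, hm, j, l, hl, hk, hi⟩ := hi
  obtain ⟨m', hm', j', l', hl', hk', hc⟩ := hc
  cases P.knot_region_unique hm hm' hk hk'
  exact P.isAncestor_of_mem_trunc hci hm hl hl' hi hc

/-- There are at most `N` knots in the ancestors of a subregion. -/
theorem card_le_N_of_isAncestor {c : Fin n} {s : Finset (Fin n)}
    (hs : ∀ i ∈ s, P.IsAncestor (P.col i) c) : s.card ≤ P.N := by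
  obtain ⟨m, hm, j, hc⟩ := P.K_cover c
  let f : ℕ → Finset (Fin n) := fun l => if h : l ≤ m then P.K l (trunc j h) else ∅
  have hf : ∀ l ∈ Finset.range (M + 1), (f l).card ≤ P.r l := by
    intro l _
    by_cases h : l ≤ m
    · simpa [f, h] using P.K_card l (h.trans hm) (trunc j h)
    · simp [f, h]
  calc s.card ≤ ((Finset.range (M + 1)).biUnion f).card := by
        refine Finset.card_le_card_of_injOn P.col ?_ P.col.injective.injOn
        intro i hi
        obtain ⟨m', hm', j', l, hl, hc', hi⟩ := hs i hi
        cases P.knot_region_unique hm hm' hc hc'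
        refine Finset.mem_coe.2 (Finset.mem_biUnion.2 ⟨l, Finset.mem_range.2 (by omega), ?_⟩)
        simpa [f, hl] using hi
    _ ≤ ∑ l ∈ Finset.range (M + 1), (f l).card := Finset.card_biUnion_le
    _ ≤ P.N := Finset.sum_le_sum hf

/-- A column of a multi-resolution factor vanishes outside the subregion of its knot. -/
theorem IsMRD.mem_I {P : Hierarchy 𝓓 n J M} {S B : Matrix (Fin n) (Fin n) ℝ} (hB : P.IsMRD S B)
    {i c : Fin n} (h : B i c ≠ 0) {m : ℕ} (hm : m ≤ M) {j : Fin m → Fin J}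
    (hc : P.col c ∈ P.K m j) : i ∈ P.I m j := by
  obtain ⟨X, -, hX⟩ := hB
  by_contra hi
  exact h ((hX m hm j c hc).2 i hi)

end Hierarchy

/-- The inverse of a matrix that is block-diagonal with respect to a labelling is
block-diagonal too. -/
theorem inv_apply_eq_zero_of_ne {ι α : Type*} [Fintype ι] [DecidableEq ι] [LinearOrder α]
    {R : Matrix ι ι ℝ} (hR : IsUnit R.det) {b : ι → α} (h : ∀ i k, b i ≠ b k → R i k = 0)
    {i k : ι} (hik : b i ≠ b k) : R⁻¹ i k = 0 := by
  have := R.invertibleOfIsUnitDet hR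
  -- A block-diagonal matrix is block-triangular for the order of the labels and for its dual; each
  -- kills the inverse on one side.
  obtain hlt | hlt := hik.lt_or_gt
  · have hb : R.BlockTriangular (OrderDual.toDual ∘ b) :=
      fun p q hpq => h p q (ne_of_lt (OrderDual.toDual_lt_toDual.1 hpq))
    exact blockTriangular_inv_of_blockTriangular hb (OrderDual.toDual_lt_toDual.2 hlt)
  · have hb : R.BlockTriangular b := fun p q hpq => h p q (ne_of_gt hpq)
    exact blockTriangular_inv_of_blockTriangular hb hlt

/-- The lower Cholesky factor inherits a sparsity pattern that is closed under fill-in. -/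
theorem IsLowerCholesky.rel_of_ne_zero {n : ℕ} {L G : Matrix (Fin n) (Fin n) ℝ}
    (hL : IsLowerCholesky L G) {E : Fin n → Fin n → Prop}
    (hG : ∀ i c, c ≤ i → G i c ≠ 0 → E i c)
    (hE : ∀ i c k, c ≤ i → E i k → E c k → E i c) {i c : Fin n} (h : L i c ≠ 0) : E i c := by
  obtain ⟨hlow, hdiag, rfl⟩ := hL
  induction c using WellFoundedLT.induction generalizing i with
  | ind c ih =>
  have hci : c ≤ i := not_lt.1 fun hlt => h (hlow i c hlt)
  -- Either an earlier column `k` produces fill-in at `(i, c)`, or all earlier terms of `(L * Lᵀ) i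
  -- c` vanish and it equals `L i c * L c c`.
  by_cases hk : ∃ k < c, L i k ≠ 0 ∧ L c k ≠ 0
  · obtain ⟨k, hkc, hik, hck⟩ := hk
    exact hE i c k hci (ih k hkc hik) (ih k hkc hck)
  · push Not at hk
    refine hG i c hci ?_
    have hsum : (L * Lᵀ) i c = L i c * L c c := by
      rw [Matrix.mul_apply]
      refine Finset.sum_eq_single c (fun k _ hkc => ?_) (by simp)
      rw [Matrix.transpose_apply]
      obtain hlt | hlt := hkc.lt_or_gt
      · by_cases hik : L i k = 0
        · rw [hik, zero_mul]
        · rw [hk k hlt hik, mul_zero]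
      · rw [hlow c k hlt, mul_zero]
    rw [hsum]
    exact mul_ne_zero h (hdiag c).ne'

/-- For block-diagonal observations, the entries of `Λ_t` on and below the diagonal vanish outside
the pairs of knots in nested subregions. -/
theorem BlockObservations.isAncestor_of_lam_ne_zero {𝓓 : Type u} {n J M : ℕ}
    {P : Hierarchy 𝓓 n J M} {Y : StateSpaceModel n} {t : ℕ} (hblock : BlockObservations P Y t)
    {S B : Matrix (Fin n) (Fin n) ℝ} (hB : P.IsMRD S B) {i c : Fin n} (hci : c ≤ i)
    (h : Y.Lam t B i c ≠ 0) : P.IsAncestor (P.col i) (P.col c) := by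
  -- Off the diagonal, the identity in `Λ_t` contributes nothing.
  obtain rfl | hlt := hci.eq_or_lt
  · exact P.isAncestor_refl _
  obtain ⟨ρ, hR, hH⟩ := hblock
  have hHB : ∀ p a, (Y.H t * B) p a ≠ 0 → ∃ (l : ℕ) (hl : l ≤ M),
      P.col a ∈ P.K l (trunc (ρ p) hl) := by
    intro p a hpa
    obtain ⟨b, -, hb⟩ := Finset.exists_ne_zero_of_sum_ne_zero (Matrix.mul_apply (M := Y.H t) ▸ hpa)
    obtain ⟨m, hm, j, ha⟩ := P.K_cover (P.col a)
    have hbj := P.mem_I.1 (hB.mem_I (right_ne_zero_of_mul hb) hm ha)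
    have hbρ := P.mem_I.1 (not_not.1 fun hn => left_ne_zero_of_mul hb (hH p b hn))
    cases P.region_index_unique hm hbj (P.region_subset_trunc hm le_rfl _ hbρ)
    exact ⟨m, hm, ha⟩
  have hexpand : Y.Lam t B i c = ∑ q, (∑ p, (Y.H t * B) p i * (Y.R t)⁻¹ p q) *
      (Y.H t * B) q c := by
    rw [StateSpaceModel.Lam, Matrix.add_apply, Matrix.one_apply_ne hlt.ne', zero_add,
      ← Matrix.transpose_mul, Matrix.mul_assoc, Matrix.mul_apply]
    simp only [Matrix.mul_apply (N := (Y.R t)⁻¹), Matrix.transpose_apply]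
  rw [hexpand] at h
  obtain ⟨q, -, hq⟩ := Finset.exists_ne_zero_of_sum_ne_zero h
  obtain ⟨p, -, hp⟩ := Finset.exists_ne_zero_of_sum_ne_zero (left_ne_zero_of_mul hq)
  have hpq : ρ p = ρ q := by
    by_contra hne
    -- `toLex` only supplies a linear order on the labels.
    exact right_ne_zero_of_mul hp (inv_apply_eq_zero_of_ne (b := fun p => toLex (ρ p))
      (Y.R_posDef t).det_pos.ne'.isUnit (fun a b hab => hR a b fun e => hab (congrArg toLex e))
      fun e => hne (toLex_inj.1 e))
  obtain ⟨l, hl, hi⟩ := hHB p i (left_ne_zero_of_mul hp)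
  obtain ⟨l', hl', hc⟩ := hHB q c (right_ne_zero_of_mul hq)
  rw [← hpq] at hc
  exact P.isAncestor_of_mem_trunc hci le_rfl hl hl' hi hc

end MRF

theorem proposition4 :
    ∃ C : ℕ, ∀ (𝓓 : Type u) (n J M : ℕ) (P : MRF.Hierarchy 𝓓 n J M)
      (Y : MRF.StateSpaceModel n) (T : ℕ)
      (Bprior Bpost L : ℕ → Matrix (Fin n) (Fin n) ℝ),
      MRF.IsFilterRun P Y T Bprior Bpost L →
      ∀ t : ℕ, 1 ≤ t → t ≤ T → MRF.BlockObservations P Y t →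
        ∀ c : Fin n, (Finset.univ.filter fun i : Fin n => L t i c ≠ 0).card ≤ C * P.N := by
  refine ⟨1, fun 𝓓 n J M P Y T Bprior Bpost L hrun t ht htT hblock c => ?_⟩
  obtain ⟨s, rfl⟩ := Nat.exists_eq_add_of_le' ht
  rw [one_mul]
  refine P.card_le_N_of_isAncestor (c := P.col c) fun i hi => ?_
  exact (hrun.cholesky s htT).rel_of_ne_zero
    (E := fun i c => P.IsAncestor (P.col i) (P.col c))
    (fun _ _ hci h => hblock.isAncestor_of_lam_ne_zero (hrun.forecast s htT) hci h)
    (fun _ _ _ hci hi hc => P.isAncestor_of_common_descendant hci hi hc)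
    (Finset.mem_filter.1 hi).2
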